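/- **Setting.** A network $\mathcal N=(\mathcal G,S,\rho)$ consists of a finite directed acyclic multigraph $\mathcal G=(\mathcal V,\mathcal E)$, distinct source nodes $S=\{\sigma_1,\dots,\sigma_s\}$ without input edges, and a sink $\rho\in\mathcal V\setminus S$ without output edges, such that there is a directed path from every other node to $\rho$. A set $C\subseteq\mathcal E$ is a cut set if deleting $C$ disconnects at least one source from $\rho$ (no directed path from it to $\rho$ remains), and $C_{\min}$ is the minimum size of a cut set. Let $f:\prod_i\mathcal A_i\to\mathcal O$ be a target function, $\zeta:\prod_i\mathcal A_i\to\mathcal Q$ a security function, and let $\mathcal B$ be the edge alphabet; all alphabets are finite. In an $(\ell,n)$ code ($\ell\ge 0$, $n\ge 1$ integers) source $\sigma_i$ holds a message $\mathbf M_i\in\mathcal A_i^{\ell}$ and a key $\mathbf K_i$ from a finite nonempty alphabet $\mathcal K_i$, all of them uniform and mutually independent. Every edge $e$ carries a word $Y_e\in\mathcal B^n$, which is a function of $(\mathbf M_i,\mathbf K_i)$ if $e$ leaves $\sigma_i$, and otherwise a function of the words on the input edges of the tail of $e$; the sink applies a decoding function to the words on its input edges. The code is admissible for $(\mathcal N,f,\mathcal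 W_r,\zeta)$, where $\mathcal W_r=\{W\subseteq\mathcal E:|W|\le r\}$, if for all messages and keys the sink outputs the $\ell$ values $f(M_{1,j},\dots,M_{s,j})$, $1\le j\le\ell$, and if for every $W\in\mathcal W_r$ the words $(Y_e)_{e\in W}$ have zero mutual information with the $\ell$ values $\zeta(M_{1,j},\dots,M_{s,j})$, $1\le j\le\ell$. A real number $R\ge0$ is achievable if for every $\epsilon>0$ there is an admissible $(\ell,n)$ code with $\ell/n>R-\epsilon$. The secure computing capacity $\widehat{\mathcal C}(\mathcal N,f,\mathcal W_r,\zeta)$ is the maximum of the set of achievable rates. **Theorem.** Let $\mathbb F_q$ be a finite field, $T\in\mathbb F_q^{s\times k}$ with $T\neq0$, and $\Upsilon\in\mathbb F_q^{s\times k'}$. Let $\mathcal A_i=\mathcal B=\mathbb F_q$, $f(m)=mT$ and $\zeta(m)=m\Upsilon$ for $m\in\mathbb F_q^s$, and let $r$ be an integer with $0\le rk\le C_{\min}$. Then the maximum defining $\widehat{\mathcal C}(\mathcal N,f,\mathcal W_r,\zeta)$ exists, and $$\widehat{\mathcal C}(\mathcal N,f,\mathcal W_r,\zeta)\ \ge\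 \frac{C_{\min}}{k}-r .$$ -/

import Mathlib

/-- A directed multigraph with node set `V` and edge set `E`; parallel edges are allowed. -/
structure MultiDigraph (V E : Type*) where
  tail : E → V
  head : E → V

namespace MultiDigraph

variable {V E : Type*} (G : MultiDigraph V E)

/-- `G.Reach C u v`: after the edges in `C` have been deleted, there is a directed path from `u` to
`v`, that is, a nonempty sequence of consecutive edges. -/
def Reach (C : Finset E) (u v : V) : Prop :=
  Relation.TransGen (fun a b => ∃ e, e ∉ C ∧ G.tail e = a ∧ G.head e = b) u v

end MultiDigraph

/-- A network: a directed acyclic multigraph with `s` distinct source nodes and a single sink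
node. Source nodes have no input edges, the sink has no output edges, and the sink can be reached
from every other node. -/
structure Network (V E : Type*) (s : ℕ) extends MultiDigraph V E where
  source : Fin s → V
  sink : V
  source_injective : Function.Injective source
  source_ne_sink : ∀ i, source i ≠ sink
  acyclic : ∀ v, ¬ toMultiDigraph.Reach ∅ v v
  head_ne_source : ∀ e i, head e ≠ source i
  tail_ne_sink : ∀ e, tail e ≠ sink
  reach_sink : ∀ v, v ≠ sink → toMultiDigraph.Reach ∅ v sink

namespace Network

variable {V E : Type*} {s : ℕ} (N : Network V E s)

/-- The input edges of a node. -/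
abbrev In (u : V) : Type _ := {d : E // N.head d = u}

/-- `I_C`: the sources that are separated from the sink once the edges in `C` are deleted. -/
def separated (C : Finset E) : Set (Fin s) :=
  {i | ¬ N.Reach C (N.source i) N.sink}

/-- The family of all cut sets. -/
def cutSets : Set (Finset E) :=
  {C | (N.separated C).Nonempty}

/-- The minimum size of a cut set. -/
noncomputable def cMin : ℕ :=
  sInf (Finset.card '' N.cutSets)

/-- If there are a source and finitely many edges, then cut sets exist, so that `cMin` is a
genuine minimum. -/
theorem cutSets_nonempty [Fintype E] (hs : 0 < s) : N.cutSets.Nonempty := by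
  refine ⟨Finset.univ, ⟨0, hs⟩, fun h => ?_⟩
  obtain ⟨_, ⟨e, he, _⟩, _⟩ := Relation.TransGen.head'_iff.1 h
  exact he (Finset.mem_univ e)

/-- In a finite network, "the edge `d` ends where the edge `e` starts" is well-founded. -/
theorem edge_wf [Finite E] : WellFounded (fun d e : E => N.head d = N.tail e) := by
  have key : ∀ d e : E, Relation.TransGen (fun d e : E => N.head d = N.tail e) d e →
      N.Reach ∅ (N.tail d) (N.tail e) := by
    intro d e h
    induction h with
    | single h => exact .single ⟨d, by simp, rfl, h⟩
    | tail _ h ih => exact ih.tail ⟨_, by simp, rfl, h⟩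
  have : Std.Irrefl (Relation.TransGen (fun d e : E => N.head d = N.tail e)) :=
    ⟨fun e h => N.acyclic _ (key e e h)⟩
  exact (Finite.wellFounded_of_trans_of_irrefl
    (Relation.TransGen (fun d e : E => N.head d = N.tail e))).mono
    (fun _ _ h => Relation.TransGen.single h)

/-- An `(ℓ, n)` function-computing network code. Source `i` holds `ℓ` symbols of the alphabet `A i`
and a key in `K i`, every edge carries `n` symbols of the alphabet `B`, and the sink outputs
`ℓ` symbols of the alphabet `O`. The local encoding function of an edge `e` is `encSource e` if
`e` leaves a source node and `encInner e` otherwise. -/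
structure Code {V E : Type*} {s : ℕ} (N : Network V E s) (A : Fin s → Type*) (B O : Type*)
    (K : Fin s → Type*) (ℓ n : ℕ) where
  encSource : ∀ (e : E) (i : Fin s), N.tail e = N.source i →
    (Fin ℓ → A i) × K i → (Fin n → B)
  encInner : ∀ e : E, (∀ i, N.tail e ≠ N.source i) →
    (N.In (N.tail e) → Fin n → B) → (Fin n → B)
  dec : (N.In N.sink → Fin n → B) → (Fin ℓ → O)

namespace Code

variable {N} {A : Fin s → Type*} {B O : Type*} {K : Fin s → Type*} {ℓ n : ℕ}

open Classical in
/-- The global encoding functions: the word carried by each edge when the source messages are `m`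
and the keys are `κ`, obtained by applying the local encoding functions recursively. -/
noncomputable def globalEnc [Finite E] (c : N.Code A B O K ℓ n) (m : ∀ i, Fin ℓ → A i)
    (κ : ∀ i, K i) : E → Fin n → B :=
  N.edge_wf.fix fun e y =>
    if h : ∃ i, N.tail e = N.source i then
      c.encSource e h.choose h.choose_spec (m h.choose, κ h.choose)
    else
      c.encInner e (not_exists.1 h) (fun d => y d.1 d.2)

theorem globalEnc_source [Finite E] (c : N.Code A B O K ℓ n) (m : ∀ i, Fin ℓ → A i)
    (κ : ∀ i, K i) (e : E) (i : Fin s) (h : N.tail e = N.source i) :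
    c.globalEnc m κ e = c.encSource e i h (m i, κ i) := by
  have h' : ∃ i, N.tail e = N.source i := ⟨i, h⟩
  have hi : h'.choose = i := N.source_injective (h'.choose_spec.symm.trans h)
  have aux : ∀ (j : Fin s) (hj : N.tail e = N.source j), j = i →
      c.encSource e j hj (m j, κ j) = c.encSource e i h (m i, κ i) := by
    rintro j hj rfl
    rfl
  unfold globalEnc
  rw [WellFounded.fix_eq, dif_pos h']
  exact aux _ _ hi

theorem globalEnc_inner [Finite E] (c : N.Code A B O K ℓ n) (m : ∀ i, Fin ℓ → A i)
    (κ : ∀ i, K i) (e : E) (h : ∀ i, N.tail e ≠ N.source i) :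
    c.globalEnc m κ e = c.encInner e h (fun d => c.globalEnc m κ d.1) := by
  unfold globalEnc
  rw [WellFounded.fix_eq, dif_neg (not_exists.2 h)]

end Code

end Network

/-- The probability that the random variable `X` equals `x`, for the uniform distribution on the
finite sample space `Ω`. -/
noncomputable def uniformProb {Ω α : Type*} (X : Ω → α) (x : α) : ℝ :=
  (Nat.card {ω // X ω = x} : ℝ) / (Nat.card Ω : ℝ)

/-- The Shannon entropy of `X` for the uniform distribution on `Ω` (natural logarithm). -/
noncomputable def shannonEntropy {Ω α : Type*} [Fintype α] (X : Ω → α) : ℝ :=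
  ∑ x, Real.negMulLog (uniformProb X x)

/-- The mutual information `I(X; Y) = H(X) + H(Y) - H(X, Y)`. -/
noncomputable def mutualInfo {Ω α β : Type*} [Fintype α] [Fintype β] (X : Ω → α) (Y : Ω → β) : ℝ :=
  shannonEntropy X + shannonEntropy Y - shannonEntropy (fun ω => (X ω, Y ω))

namespace Network

variable {V E : Type*} {s : ℕ} {N : Network V E s}

/-- The `ℓ` values of the function `g` at the source messages `m`. -/
def evalEach {A : Fin s → Type*} {O : Type*} {ℓ : ℕ} (g : (∀ i, A i) → O)
    (m : ∀ i, Fin ℓ → A i) : Fin ℓ → O :=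
  fun j => g (fun i => m i j)

/-- Computability: the sink computes the target function `f` with zero error. -/
def Code.Computes [Finite E] {A : Fin s → Type*} {B O : Type*} {K : Fin s → Type*} {ℓ n : ℕ}
    (c : N.Code A B O K ℓ n) (f : (∀ i, A i) → O) : Prop :=
  ∀ (m : ∀ i, Fin ℓ → A i) (κ : ∀ i, K i),
    c.dec (fun d => c.globalEnc m κ d.1) = evalEach f m

/-- Security (for finite alphabets): for source messages and keys that are jointly uniform (so all of them are uniform
and mutually independent), the words on the edges of any wiretap set carry no information on the
`ℓ` values of the security function `ζ`. -/
def Code.Secure [Fintype E] [DecidableEq E] {A : Fin s → Type*} {B O Q : Type*} [Fintype B]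
    [Fintype Q] {K : Fin s → Type*} {ℓ n : ℕ} (c : N.Code A B O K ℓ n)
    (𝒲 : Set (Finset E)) (ζ : (∀ i, A i) → Q) : Prop :=
  ∀ W ∈ 𝒲,
    mutualInfo (Ω := (∀ i, Fin ℓ → A i) × (∀ i, K i))
      (fun ω (e : W) => c.globalEnc ω.1 ω.2 e)
      (fun ω => evalEach ζ ω.1) = 0

/-- There is an admissible `(ℓ, n)` code, for some finite key alphabets. -/
def ExistsAdmissibleCode [Fintype E] [DecidableEq E] (N : Network V E s) {A : Fin s → Type*}
    (B : Type*) {O Q : Type*} [Fintype B] [Fintype Q] (f : (∀ i, A i) → O)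
    (𝒲 : Set (Finset E)) (ζ : (∀ i, A i) → Q) (ℓ n : ℕ) : Prop :=
  ∃ K : Fin s → Type, (∀ i, Finite (K i) ∧ Nonempty (K i)) ∧
    ∃ c : N.Code A B O K ℓ n, c.Computes f ∧ c.Secure 𝒲 ζ

/-- The secure computing rate region: all achievable nonnegative rates. The trivial codes with
`ℓ = 0` are admitted, so the rate `0` is always achievable. -/
def rateRegion [Fintype E] [DecidableEq E] (N : Network V E s) {A : Fin s → Type*}
    (B : Type*) {O Q : Type*} [Fintype B] [Fintype Q] (f : (∀ i, A i) → O)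
    (𝒲 : Set (Finset E)) (ζ : (∀ i, A i) → Q) : Set ℝ :=
  {R | 0 ≤ R ∧ ∀ ε : ℝ, 0 < ε → ∃ ℓ n : ℕ, 0 < n ∧
    N.ExistsAdmissibleCode B f 𝒲 ζ ℓ n ∧ R - ε < (ℓ : ℝ) / (n : ℝ)}

/-- The secure computing capacity: the largest achievable rate. -/
noncomputable def secureCapacity [Fintype E] [DecidableEq E] (N : Network V E s)
    {A : Fin s → Type*} (B : Type*) {O Q : Type*} [Fintype B] [Fintype Q] (f : (∀ i, A i) → O)
    (𝒲 : Set (Finset E)) (ζ : (∀ i, A i) → Q) : ℝ :=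
  sSup (N.rateRegion B f 𝒲 ζ)

end Network

/-- The wiretap collection of security level `r`: all sets of at most `r` edges. -/
def wiretapSets (E : Type*) (r : ℕ) : Set (Finset E) :=
  {W | W.card ≤ r}

/-- The vector-linear function `m ↦ m M` given by a matrix `M`. -/
def vecLinear {F : Type*} [Field F] {s k : ℕ} (M : Matrix (Fin s) (Fin k) F) :
    (Fin s → F) → (Fin k → F) :=
  fun m => Matrix.vecMul m M

/-! Let `L` be a large finite extension of the base field `F` and `M = L ^ cMin`.

Summation. Each edge `d` gets a vector `b d` in `M`, chosen backwards from the sink and generically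
in the span of the vectors leaving its head (all of `M` at the sink). If the vectors leaving some
source failed to span `M`, a cut with fewer than `cMin` edges would appear (`span_source_eq_top`).
So source `i` can expand its vector `x i` along its output edges, and every inner node can re-expand
each incoming `b d` along its own output edges. The weighted sum of the `b d` is conserved along the
flow, and the sink reads `∑ i, x i` (`exists_linear_sum_code`).

Secrecy. A generic subspace `Z` of dimension at most `r` detects every nonzero functional in the
span of the functionals on `r` edges (`exists_submodule_forall_eq_zero`). With messages in `M ⧸ Z`
and keys in `Z`, any change of messages can be hidden from a wiretapper by a shift of the keys, so
the observation is independent of all messages and hence of every security function. The sink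
reduces modulo `Z`, which removes the keys.

One run for each of the `k` columns of `T` gives rate `dim (M ⧸ Z) / k`, at least `(cMin - r) / k`
and hence at least `cMin / k - r`. The maximum exists because rates are bounded by the number of
edges. -/

/-! ### Generic vectors and dimension counts -/

/-- Recursive construction along a well-founded relation, in the form of an existence statement. -/
theorem WellFounded.exists_rec_spec {α β : Type*} {r : α → α → Prop} (hr : WellFounded r)
    (P : ∀ a : α, ({b // r b a} → β) → β → Prop) (hP : ∀ a g, ∃ x, P a g x) :
    ∃ f : α → β, ∀ a, P a (fun b => f b.1) (f a) := by
  choose x hx using hP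
  refine ⟨hr.fix fun a y => x a fun b => y b.1 b.2, fun a => ?_⟩
  rw [WellFounded.fix_eq hr _ a]
  exact hx a _

/-- Over a sufficiently large field, a subspace contains a vector that avoids finitely many
subspaces, none of which contains it. -/
theorem Submodule.exists_mem_forall_notMem_of_card_lt {ι K M : Type*} [Fintype ι] [Field K]
    [AddCommGroup M] [Module K M] (U : Submodule K M) (p : ι → Submodule K M)
    (h : (Fintype.card ι : ENat) < ENat.card K) :
    ∃ x ∈ U, ∀ i, ¬ U ≤ p i → x ∉ p i := by
  classical
  let J := {i // ¬ U ≤ p i}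
  have h₁ : ∀ j : J, (p j).comap U.subtype ≠ ⊤ := fun j hj => j.2 fun u hu => by
    have : (⟨u, hu⟩ : U) ∈ (p j).comap U.subtype := hj ▸ Submodule.mem_top
    simpa using this
  have h₂ : ((Finset.univ : Finset J).card : ENat) < ENat.card K :=
    lt_of_le_of_lt (by exact_mod_cast Fintype.card_subtype_le _) h
  -- A vector space is not a union of fewer proper subspaces than its field has elements.
  have := Submodule.iUnion_ssubset_of_forall_ne_top_of_card_lt Finset.univ _ h₁ h₂
  obtain ⟨x, hx⟩ := (Set.ne_univ_iff_exists_notMem _).1 this.ne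
  refine ⟨x, x.2, fun i hi hxi => hx ?_⟩
  simp only [Set.mem_iUnion]
  exact ⟨⟨i, hi⟩, Finset.mem_univ _, hxi⟩

/-- If no vector of a finite family lies in the span of its predecessors, then the family has at
most as many members as the dimension of its span. -/
theorem card_le_finrank_span_of_notMem_span_lt {ι K M : Type*} [LinearOrder ι] [Field K]
    [AddCommGroup M] [Module K M] [FiniteDimensional K M] (b : ι → M) (S : Finset ι)
    (h : ∀ d ∈ S, b d ∉ Submodule.span K (b '' {e | e ∈ S ∧ e < d})) :
    S.card ≤ Module.finrank K (Submodule.span K (b '' (S : Set ι))) := by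
  induction S using Finset.induction_on_max with
  | empty => simp
  | insert a P ha ih =>
    have haP : a ∉ P := fun h' => lt_irrefl _ (ha a h')
    have ih' := ih fun d hd hmem => h d (Finset.mem_insert_of_mem hd)
      (Submodule.span_mono (Set.image_mono (by
        rintro e ⟨he, hed⟩
        exact ⟨Finset.mem_insert_of_mem he, hed⟩)) hmem)
    have hnot : b a ∉ Submodule.span K (b '' (P : Set ι)) := fun hmem =>
      h a (Finset.mem_insert_self _ _) (Submodule.span_mono
        (Set.image_mono (by
        intro e he
        exact ⟨Finset.mem_insert_of_mem he, ha e he⟩)) hmem)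
    rw [Finset.card_insert_of_notMem haP]
    refine Nat.succ_le_of_lt (lt_of_le_of_lt ih' (Submodule.finrank_lt_finrank_of_lt ?_))
    refine lt_of_le_of_ne (Submodule.span_mono (Set.image_mono (by simp))) fun heq => hnot ?_
    rw [heq]
    exact Submodule.subset_span ⟨a, by simp, rfl⟩

/-! ### Generic coding vectors and the minimum cut -/

namespace Network

variable {V E : Type*} {s : ℕ} (N : Network V E s)

/-- The edges of a network can be ordered linearly so that every edge comes after the output
edges of its head. -/
theorem exists_linearOrder_edges [Finite E] :
    ∃ o : LinearOrder E, ∀ d e, N.head d = N.tail e → o.lt e d := by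
  let R : E → E → Prop := fun e d => N.head d = N.tail e
  have key : ∀ e d, Relation.TransGen R e d → N.Reach ∅ (N.tail d) (N.tail e) := by
    intro e d h
    induction h with
    | single h => exact .single ⟨_, by simp, rfl, h⟩
    | tail _ h ih => exact .head ⟨_, by simp, rfl, h⟩ ih
  -- `R` points against the flow; acyclicity makes its closure antisymmetric, and any linear
  -- extension serves.
  let po : PartialOrder E :=
    { le := Relation.ReflTransGen R
      le_refl := fun _ => .refl
      le_trans := fun _ _ _ => .trans
      le_antisymm := fun a b hab hba => by
        rcases Relation.reflTransGen_iff_eq_or_transGen.1 hab with h | h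
        · exact h.symm
        · exact (N.acyclic _ (key _ _ (Relation.TransGen.trans_left h hba))).elim }
  let lo : LinearOrder (@LinearExtension E) := inferInstance
  refine ⟨lo, fun d e h => lt_of_le_of_ne (α := LinearExtension E) ?_ ?_⟩
  · exact toLinearExtension.monotone' (show e ≤ d from .single h)
  · rintro rfl
    exact N.acyclic _ (key _ _ (.single h))

/-- The output edges of a node. -/
abbrev outEdges (v : V) : Set E := {e | N.tail e = v}

open Classical in
/-- The vectors that are available to the input edges of the node `v`. -/
noncomputable def available (K : Type*) {M : Type*} [Field K] [AddCommGroup M] [Module K M]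
    (b : E → M) (v : V) : Submodule K M :=
  -- The sink has no output edges, so the span would be zero there; `⊤` starts the backward
  -- construction.
  if v = N.sink then ⊤ else Submodule.span K (b '' N.outEdges v)

/-- Generic coding vectors, chosen from the sink towards the sources. -/
theorem exists_generic_vectors [Fintype E] [LinearOrder E]
    (ho : ∀ d e : E, N.head d = N.tail e → e < d) (K M : Type*) [Field K] [AddCommGroup M]
    [Module K M] (hK : ((2 ^ Fintype.card E : ℕ) : ENat) < ENat.card K) :
    ∃ b : E → M, ∀ d, b d ∈ N.available K b (N.head d) ∧
      ∀ S : Set E, (∀ e ∈ S, e < d) → b d ∈ Submodule.span K (b '' S) →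
        N.available K b (N.head d) ≤ Submodule.span K (b '' S) := by
  classical
  let A : ∀ d : E, ({e : E // e < d} → M) → Submodule K M := fun d g =>
    if N.head d = N.sink then ⊤ else Submodule.span K (g '' {e | N.tail e.1 = N.head d})
  obtain ⟨b, hb⟩ := (wellFounded_lt (α := E)).exists_rec_spec (β := M)
    (fun d g x => x ∈ A d g ∧ ∀ S : Set {e : E // e < d}, x ∈ Submodule.span K (g '' S) →
      A d g ≤ Submodule.span K (g '' S)) (fun d g => by
        -- The spans to be avoided are indexed by sets of earlier edges, of which there are at most
        -- `2 ^ |E|`.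
        obtain ⟨x, hx, h⟩ := (A d g).exists_mem_forall_notMem_of_card_lt
          (fun S : Finset {e : E // e < d} => Submodule.span K (g '' (S : Set _)))
          (lt_of_le_of_lt (by
            rw [Fintype.card_finset]
            exact_mod_cast Nat.pow_le_pow_right two_pos (Fintype.card_subtype_le _)) hK)
        refine ⟨x, hx, fun S hS => ?_⟩
        by_contra hle
        exact h S.toFinset (by simpa using hle) (by simpa using hS))
  refine ⟨b, fun d => ?_⟩
  have hA : A d (fun e => b e.1) = N.available K b (N.head d) := by
    unfold available
    by_cases h : N.head d = N.sink
    · simp [A, h]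
    · simp only [A, h, if_false]
      congr 1
      ext x
      constructor
      · rintro ⟨e, he, rfl⟩
        exact ⟨e, he, rfl⟩
      · rintro ⟨e, he, rfl⟩
        exact ⟨⟨e, ho d e he.symm⟩, he, rfl⟩
  obtain ⟨h1, h2⟩ := hb d
  rw [hA] at h1 h2
  refine ⟨h1, fun S hS hmem => ?_⟩
  have hS' : (fun e : {e : E // e < d} => b e.1) '' {e | e.1 ∈ S} = b '' S := by
    ext x
    constructor
    · rintro ⟨e, he, rfl⟩
      exact ⟨e, he, rfl⟩
    · rintro ⟨e, he, rfl⟩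
      exact ⟨⟨e, hS e he⟩, he, rfl⟩
  rw [← hS']
  exact h2 _ (by rwa [hS'])

/-- If no cut set has fewer elements than the dimension, then generic coding vectors on the
output edges of a source span the whole space. -/
theorem span_source_eq_top [Fintype E] [LinearOrder E] {K M : Type*} [Field K] [AddCommGroup M]
    [Module K M] [FiniteDimensional K M] (b : E → M)
    (hb : ∀ d, ∀ S : Set E, (∀ e ∈ S, e < d) → b d ∈ Submodule.span K (b '' S) →
        N.available K b (N.head d) ≤ Submodule.span K (b '' S))
    (hC : Module.finrank K M ≤ N.cMin) (i : Fin s) :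
    Submodule.span K (b '' N.outEdges (N.source i)) = ⊤ := by
  classical
  by_contra hne
  set U := Submodule.span K (b '' N.outEdges (N.source i)) with hU
  let early : E → Set E := fun d => {e | b e ∈ U ∧ e < d}
  -- A greedy independent selection among the edges with vector in `U`. It has at most `dim U <
  -- cMin` members and is shown to be a cut.
  let S : Finset E := {d | b d ∈ U ∧ b d ∉ Submodule.span K (b '' early d)}
  have hSU : Submodule.span K (b '' (S : Set E)) ≤ U := by
    rw [Submodule.span_le]
    rintro _ ⟨d, hd, rfl⟩
    simp only [S, Finset.coe_filter, Finset.mem_univ, true_and, Set.mem_ofPred_eq] at hd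
    exact hd.1
  have hcard : S.card ≤ Module.finrank K U := by
    refine (card_le_finrank_span_of_notMem_span_lt (K := K) b S fun d hd hmem => ?_).trans
      (Submodule.finrank_mono hSU)
    simp only [S, Finset.mem_filter, Finset.mem_univ, true_and] at hd
    refine hd.2 (Submodule.span_mono (Set.image_mono ?_) hmem)
    rintro e ⟨he, hed⟩
    simp only [S, Finset.mem_filter, Finset.mem_univ, true_and] at he
    exact ⟨he.1, hed⟩
  have hlt : Module.finrank K U < Module.finrank K M := Submodule.finrank_lt hne
  -- By genericity, `b d` depends on earlier vectors of `U` only if everything available at the head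
  -- of `d` lies in `U`. At the sink this would force `U = ⊤`.
  have hnext : ∀ d, b d ∈ U → d ∉ S → N.head d ≠ N.sink ∧
      b '' N.outEdges (N.head d) ⊆ U := by
    intro d hd hdS
    have hmem : b d ∈ Submodule.span K (b '' early d) := by
      by_contra h
      exact hdS (by simp [S, hd, h])
    have h1 := hb d (early d) (fun e he => he.2) hmem
    have h2 : Submodule.span K (b '' early d) ≤ U := by
      rw [Submodule.span_le]
      rintro _ ⟨e, he, rfl⟩
      exact he.1
    have h3 := h1.trans h2
    unfold available at h3
    split_ifs at h3 with h
    · exact (hne (top_le_iff.1 h3)).elim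
    · exact ⟨h, Submodule.span_le.1 h3⟩
  have hcut : S ∈ N.cutSets := by
    refine ⟨i, fun hreach => ?_⟩
    -- Along a path that avoids `S`, the vectors never leave `U`, so the path cannot end at the
    -- sink.
    have : ∀ v, N.Reach S (N.source i) v → v ≠ N.sink ∧ b '' N.outEdges v ⊆ U := by
      intro v hv
      induction hv with
      | single h =>
        obtain ⟨e, heS, ht, rfl⟩ := h
        exact hnext e (Submodule.subset_span ⟨e, ht, rfl⟩) heS
      | tail _ h ih =>
        obtain ⟨e, heS, ht, rfl⟩ := h
        exact hnext e (ih.2 ⟨e, ht, rfl⟩) heS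
    exact (this _ hreach).1 rfl
  have : N.cMin ≤ S.card := Nat.sInf_le ⟨S, hcut, rfl⟩
  omega

end Network

/-! ### A linear code for the sum of the source vectors -/

namespace Network

variable {V E : Type*} {s : ℕ} (N : Network V E s)

open Classical in
/-- The linear combination of the vectors on the output edges of `v` with given coefficients. -/
noncomputable def outCombination [Fintype E] {K M : Type*} [Field K] [AddCommGroup M] [Module K M]
    (b : E → M) (v : V) : (E → K) →ₗ[K] M :=
  ∑ e, if N.tail e = v then (LinearMap.proj e).smulRight (b e) else 0

open Classical in
theorem outCombination_apply [Fintype E] {K M : Type*} [Field K] [AddCommGroup M] [Module K M]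
    (b : E → M) (v : V) (c : E → K) :
    N.outCombination b v c = ∑ e, if N.tail e = v then c e • b e else 0 := by
  simp only [outCombination, LinearMap.sum_apply]
  refine Finset.sum_congr rfl fun e _ => ?_
  split_ifs <;> simp

theorem span_outEdges_le_range [Fintype E] {K M : Type*} [Field K] [AddCommGroup M] [Module K M]
    (b : E → M) (v : V) :
    Submodule.span K (b '' N.outEdges v) ≤ LinearMap.range (N.outCombination (K := K) b v) := by
  classical
  rw [Submodule.span_le]
  rintro _ ⟨e, he, rfl⟩
  refine ⟨Pi.single e 1, ?_⟩
  rw [outCombination_apply, Finset.sum_eq_single e]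
  · have he' : N.tail e = v := he
    simp [he']
  · intro d _ hd
    simp [Pi.single_eq_of_ne hd]
  · simp

open Classical in
/-- A scalar linear code for the sum of the source vectors: if the dimension is at most the minimum
cut size and the field is large enough, then the sink can compute the sum of the vectors held by
the sources, where each edge carries a linear functional of these vectors. -/
theorem exists_linear_sum_code [Fintype E] (K M : Type*) [Field K] [AddCommGroup M]
    [Module K M] [FiniteDimensional K M] (hK : ((2 ^ Fintype.card E : ℕ) : ENat) < ENat.card K)
    (hC : Module.finrank K M ≤ N.cMin) :
    ∃ (b : E → M) (g : Fin s → E → M →ₗ[K] K) (k : E → E → K) (Y : E → (Fin s → M) →ₗ[K] K),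
      (∀ e i, N.tail e = N.source i → ∀ x, Y e x = g i e (x i)) ∧
      (∀ e, (∀ i, N.tail e ≠ N.source i) → ∀ x,
        Y e x = ∑ d, if N.head d = N.tail e then k d e * Y d x else 0) ∧
      ∀ x, ∑ d, (if N.head d = N.sink then Y d x • b d else 0) = ∑ i, x i := by
  obtain ⟨o, ho⟩ := N.exists_linearOrder_edges
  obtain ⟨b, hb⟩ := N.exists_generic_vectors ho K M hK
  have hsrc := N.span_source_eq_top b (fun d => (hb d).2) hC
  -- The spanning property lets each source expand its vector along its output edges, linearly in
  -- that vector.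
  have hg : ∀ i, ∃ g : M →ₗ[K] E → K, N.outCombination b (N.source i) ∘ₗ g = LinearMap.id := by
    intro i
    exact LinearMap.exists_rightInverse_of_surjective _
      (top_le_iff.1 ((hsrc i).ge.trans (N.span_outEdges_le_range b _)))
  choose g hg using hg
  have hk : ∀ d, ∃ c : E → K, N.head d ≠ N.sink →
      b d = ∑ e, if N.tail e = N.head d then c e • b e else 0 := by
    intro d
    by_cases h : N.head d = N.sink
    · exact ⟨0, fun h' => (h' h).elim⟩
    · have h1 := (hb d).1
      rw [available, if_neg h] at h1
      obtain ⟨c, hc⟩ := N.span_outEdges_le_range b _ h1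
      exact ⟨c, fun _ => by rw [← hc, outCombination_apply]⟩
  choose k hk using hk
  obtain ⟨Y, hY⟩ := N.edge_wf.exists_rec_spec (β := (Fin s → M) →ₗ[K] K)
    (fun e y x => (∀ i, N.tail e = N.source i → x = LinearMap.proj e ∘ₗ g i ∘ₗ LinearMap.proj i) ∧
      ((∀ i, N.tail e ≠ N.source i) →
        x = ∑ d, if h : N.head d = N.tail e then k d e • y ⟨d, h⟩ else 0)) (fun e y => by
      by_cases h : ∃ i, N.tail e = N.source i
      · obtain ⟨i, hi⟩ := h
        refine ⟨LinearMap.proj e ∘ₗ g i ∘ₗ LinearMap.proj i, fun j hj => ?_, fun h' => (h' i hi).elim⟩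
        rw [N.source_injective (hi.symm.trans hj)]
      · exact ⟨_, fun i hi => (h ⟨i, hi⟩).elim, fun _ => rfl⟩)
  have hY1 : ∀ e i, N.tail e = N.source i → ∀ x, Y e x = g i (x i) e := by
    intro e i h x
    rw [(hY e).1 i h]
    rfl
  have hY2 : ∀ e, (∀ i, N.tail e ≠ N.source i) → ∀ x,
      Y e x = ∑ d, if N.head d = N.tail e then k d e * Y d x else 0 := by
    intro e h x
    rw [(hY e).2 h, LinearMap.sum_apply]
    refine Finset.sum_congr rfl fun d _ => ?_
    split_ifs <;> simp
  refine ⟨b, fun i e => LinearMap.proj e ∘ₗ g i, k, Y, hY1, hY2, fun x => ?_⟩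
  have hsplit : ∑ d, Y d x • b d = ∑ d, (if N.head d = N.sink then Y d x • b d else 0) +
      ∑ d, (if N.head d = N.sink then 0 else Y d x • b d) := by
    rw [← Finset.sum_add_distrib]
    refine Finset.sum_congr rfl fun d _ => ?_
    split_ifs <;> simp
  have hsplit' : ∑ e, Y e x • b e =
      ∑ e, (if ∃ i, N.tail e = N.source i then Y e x • b e else 0) +
      ∑ e, (if ∃ i, N.tail e = N.source i then 0 else Y e x • b e) := by
    rw [← Finset.sum_add_distrib]
    refine Finset.sum_congr rfl fun d _ => ?_
    split_ifs <;> simp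
  -- Conservation: expanding each incoming `b d` along the output edges of its head turns the sum
  -- over edges entering non-sink nodes into the sum over edges leaving non-source nodes.
  have hflow : ∑ d, (if N.head d = N.sink then 0 else Y d x • b d) =
      ∑ e, (if ∃ i, N.tail e = N.source i then 0 else Y e x • b e) := by
    have h1 : ∀ d, (if N.head d = N.sink then 0 else Y d x • b d) =
        ∑ e, if N.head d = N.tail e then (k d e * Y d x) • b e else 0 := by
      intro d
      split_ifs with h
      · refine (Finset.sum_eq_zero fun e _ => if_neg fun h' => ?_).symm
        exact N.tail_ne_sink e (h'.symm.trans h)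
      · conv_lhs => rw [hk d h, Finset.smul_sum]
        refine Finset.sum_congr rfl fun e _ => ?_
        by_cases h' : N.head d = N.tail e
        · rw [if_pos h', if_pos h'.symm, smul_smul, mul_comm]
        · rw [if_neg h', if_neg (Ne.symm h'), smul_zero]
    rw [Finset.sum_congr rfl fun d _ => h1 d, Finset.sum_comm]
    refine Finset.sum_congr rfl fun e _ => ?_
    split_ifs with h
    · obtain ⟨i, hi⟩ := h
      exact Finset.sum_eq_zero fun d _ => if_neg fun h' => N.head_ne_source d i (h'.trans hi)
    · rw [hY2 e (not_exists.1 h), Finset.sum_smul]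
      refine Finset.sum_congr rfl fun d _ => ?_
      split_ifs <;> simp
  have hsource : ∑ e, (if ∃ i, N.tail e = N.source i then Y e x • b e else 0) = ∑ i, x i := by
    have h1 : ∀ i, x i = ∑ e, if N.tail e = N.source i then g i (x i) e • b e else 0 := by
      intro i
      rw [← outCombination_apply]
      exact (LinearMap.congr_fun (hg i) (x i)).symm
    rw [Finset.sum_congr rfl fun i _ => h1 i, Finset.sum_comm]
    refine Finset.sum_congr rfl fun e _ => ?_
    split_ifs with h
    · obtain ⟨i, hi⟩ := h
      rw [Finset.sum_eq_single i, if_pos hi, hY1 e i hi]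
      · intro j _ hj
        exact if_neg fun h' => hj (N.source_injective (h'.symm.trans hi))
      · simp
    · exact (Finset.sum_eq_zero fun i _ => if_neg fun h' => h ⟨i, h'⟩).symm
  rw [hsplit, hflow] at hsplit'
  rw [← hsource]
  exact add_right_cancel hsplit'

end Network

/-! ### Independence and mutual information -/

theorem uniformProb_sum {Ω α : Type*} [Finite Ω] [Nonempty Ω] [Fintype α] (X : Ω → α) :
    ∑ x, uniformProb X x = 1 := by
  classical
  have := Fintype.ofFinite Ω
  have h : ∑ x, Nat.card {ω // X ω = x} = Nat.card Ω := by
    rw [← Nat.card_sigma]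
    exact Nat.card_congr (Equiv.sigmaFiberEquiv X)
  unfold uniformProb
  rw [← Finset.sum_div, ← Nat.cast_sum, h]
  exact div_self (by exact_mod_cast Nat.card_pos.ne')

/-- Independent random variables have zero mutual information. -/
theorem mutualInfo_eq_zero_of_forall_mul {Ω α β : Type*} [Finite Ω] [Nonempty Ω] [Fintype α]
    [Fintype β] (X : Ω → α) (Y : Ω → β)
    (h : ∀ x y, uniformProb (fun ω => (X ω, Y ω)) (x, y) = uniformProb X x * uniformProb Y y) :
    mutualInfo X Y = 0 := by
  unfold mutualInfo shannonEntropy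
  rw [Fintype.sum_prod_type]
  simp_rw [h, Real.negMulLog_mul, Finset.sum_add_distrib, ← Finset.sum_mul, ← Finset.mul_sum,
    ← Finset.sum_mul, uniformProb_sum]
  ring

/-- If the conditional law of `X` given the first component does not depend on it, then `X` has
zero mutual information with every function of the first component. -/
theorem mutualInfo_eq_zero_of_card_fiber {Ω₁ Ω₂ α β : Type*} [Finite Ω₁] [Nonempty Ω₁] [Finite Ω₂]
    [Nonempty Ω₂] [Fintype α] [Fintype β] (X : Ω₁ × Ω₂ → α) (Y : Ω₁ → β)
    (h : ∀ x m m', Nat.card {κ // X (m, κ) = x} = Nat.card {κ // X (m', κ) = x}) :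
    mutualInfo X (fun ω => Y ω.1) = 0 := by
  classical
  obtain ⟨m₀⟩ := ‹Nonempty Ω₁›
  have : Nonempty Ω₁ := ⟨m₀⟩
  have hX : ∀ x, Nat.card {ω // X ω = x} = Nat.card Ω₁ * Nat.card {κ // X (m₀, κ) = x} := by
    intro x
    have e : {ω // X ω = x} ≃ Σ m, {κ // X (m, κ) = x} :=
      { toFun := fun ω => ⟨ω.1.1, ω.1.2, ω.2⟩
        invFun := fun p => ⟨(p.1, p.2.1), p.2.2⟩
        left_inv := fun _ => rfl
        right_inv := fun _ => rfl }
    have := Fintype.ofFinite Ω₁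
    rw [Nat.card_congr e, Nat.card_sigma, Finset.sum_congr rfl fun m _ => h x m m₀]
    simp
  have hY : ∀ y, Nat.card {ω : Ω₁ × Ω₂ // Y ω.1 = y} = Nat.card {m // Y m = y} * Nat.card Ω₂ := by
    intro y
    rw [← Nat.card_prod]
    exact Nat.card_congr
      { toFun := fun ω => (⟨ω.1.1, ω.2⟩, ω.1.2)
        invFun := fun p => ⟨(p.1.1, p.2), p.1.2⟩
        left_inv := fun _ => rfl
        right_inv := fun _ => rfl }
  have hXY : ∀ x y, Nat.card {ω : Ω₁ × Ω₂ // (X ω, Y ω.1) = (x, y)} =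
      Nat.card {m // Y m = y} * Nat.card {κ // X (m₀, κ) = x} := by
    intro x y
    have e : {ω : Ω₁ × Ω₂ // (X ω, Y ω.1) = (x, y)} ≃
        Σ m : {m // Y m = y}, {κ // X (m.1, κ) = x} :=
      { toFun := fun ω => ⟨⟨ω.1.1, (Prod.ext_iff.1 ω.2).2⟩, ω.1.2, (Prod.ext_iff.1 ω.2).1⟩
        invFun := fun p => ⟨(p.1.1, p.2.1), Prod.ext p.2.2 p.1.2⟩
        left_inv := fun _ => rfl
        right_inv := fun _ => rfl }
    have := Fintype.ofFinite {m // Y m = y}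
    rw [Nat.card_congr e, Nat.card_sigma, Finset.sum_congr rfl fun m _ => h x m.1 m₀]
    simp
  refine mutualInfo_eq_zero_of_forall_mul _ _ fun x y => ?_
  have h1 : (Nat.card Ω₁ : ℝ) ≠ 0 := by exact_mod_cast Nat.card_pos.ne'
  have h2 : (Nat.card Ω₂ : ℝ) ≠ 0 := by exact_mod_cast Nat.card_pos.ne'
  unfold uniformProb
  rw [hX, hY, hXY, Nat.card_prod]
  push_cast
  field_simp

/-! ### The masking subspace -/

/-- For finitely many spaces of functionals of dimension at most `r` on `s` copies of `M`, there is
a subspace `Z` of `M` of dimension at most `r` such that no nonzero functional in these spaces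
vanishes on all vectors with components in `Z`. -/
theorem exists_submodule_forall_eq_zero {ι K M : Type*} [Fintype ι] {s : ℕ} [Field K]
    [AddCommGroup M] [Module K M] [FiniteDimensional K M]
    (hK : (Fintype.card ι : ENat) < ENat.card K) (r : ℕ)
    (P : ι → Submodule K ((Fin s → M) →ₗ[K] K)) (hP : ∀ j, Module.finrank K (P j) ≤ r) :
    ∃ Z : Submodule K M, Module.finrank K Z ≤ r ∧
      ∀ j, ∀ φ ∈ P j, (∀ x : Fin s → M, (∀ i, x i ∈ Z) → φ x = 0) → φ = 0 := by
  induction r generalizing P with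
  | zero =>
    refine ⟨⊥, by simp, fun j φ hφ _ => ?_⟩
    have : P j = ⊥ := Submodule.finrank_eq_zero.1 (Nat.le_zero.1 (hP j))
    simpa [this] using hφ
  | succ r ih =>
    -- `p j` is the kernel of one nonzero component of some `φ` in `P j`; the default `⊤` imposes
    -- nothing when `P j = ⊥`.
    have hp : ∀ j, ∃ p : Submodule K M, P j ≠ ⊥ → p ≠ ⊤ ∧
        ∃ φ ∈ P j, ∃ i, ∀ z ∉ p, φ (Pi.single i z) ≠ 0 := by
      intro j
      by_cases h : P j = ⊥
      · exact ⟨⊤, fun h' => (h' h).elim⟩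
      · obtain ⟨φ, hφ, hφ0⟩ := (Submodule.ne_bot_iff _).1 h
        have : ∃ i, φ ∘ₗ LinearMap.single K (fun _ => M) i ≠ 0 := by
          by_contra! hall
          refine hφ0 (LinearMap.pi_ext fun i z => ?_)
          exact LinearMap.congr_fun (hall i) z
        obtain ⟨i, hi⟩ := this
        exact ⟨_, fun _ => ⟨fun htop => hi (LinearMap.ker_eq_top.1 htop), φ, hφ, i, fun z hz => hz⟩⟩
    choose p hp using hp
    obtain ⟨z, -, hz⟩ := (⊤ : Submodule K M).exists_mem_forall_notMem_of_card_lt p hK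
    -- The functionals that `z` fails to detect in any coordinate. The choice of `z` makes this a
    -- proper subspace of each nonzero `P j`, so the induction applies with `r`.
    let P' : ι → Submodule K ((Fin s → M) →ₗ[K] K) := fun j =>
      P j ⊓ ⨅ i, LinearMap.ker (LinearMap.applyₗ (R := K) (M₂ := K) (Pi.single i z : Fin s → M))
    have hmem : ∀ j φ, φ ∈ P' j ↔ φ ∈ P j ∧ ∀ i, φ (Pi.single i z) = 0 := by
      intro j φ
      simp [P']
    have hP' : ∀ j, Module.finrank K (P' j) ≤ r := by
      intro j
      by_cases h : P j = ⊥
      · have : P' j = ⊥ := by simp [P', h]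
        rw [this, finrank_bot]
        exact Nat.zero_le r
      · obtain ⟨htop, φ, hφ, i, hi⟩ := hp j h
        have hlt : P' j < P j := by
          refine lt_of_le_of_ne inf_le_left fun heq => ?_
          rw [← heq, hmem] at hφ
          exact hi z (hz j fun hle => htop (top_le_iff.1 hle)) (hφ.2 i)
        have := Submodule.finrank_lt_finrank_of_lt hlt
        have := hP j
        omega
    obtain ⟨Z, hZ, hZP⟩ := ih P' hP'
    refine ⟨Submodule.span K {z} ⊔ Z, ?_, fun j φ hφ hvan => ?_⟩
    · have h1 := Submodule.finrank_add_le_finrank_add_finrank (Submodule.span K {z}) Z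
      have h2 : Module.finrank K (Submodule.span K {z}) ≤ 1 := by
        simpa using finrank_span_le_card (R := K) ({z} : Set M)
      omega
    · refine hZP j φ ((hmem j φ).2 ⟨hφ, fun i => hvan _ fun i' => ?_⟩) fun x hx =>
        hvan x fun i => Submodule.mem_sup_right (hx i)
      refine Submodule.mem_sup_left ?_
      by_cases h : i' = i
      · subst h
        simp
      · simp [h]

/-- If no nonzero combination of the functionals `Y e` vanishes on a subspace, then every value
of the family of functionals is attained on this subspace. -/
theorem exists_mem_forall_apply_eq {ι K X : Type*} [Fintype ι] [Field K] [AddCommGroup X]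
    [Module K X] (Y : ι → X →ₗ[K] K) (U : Submodule K X)
    (h : ∀ φ ∈ Submodule.span K (Set.range Y), (∀ u ∈ U, φ u = 0) → φ = 0) (x : X) :
    ∃ u ∈ U, ∀ e, Y e u = Y e x := by
  classical
  let A : X →ₗ[K] ι → K := LinearMap.pi Y
  suffices hx : A x ∈ U.map A by
    obtain ⟨u, hu, hux⟩ := hx
    exact ⟨u, hu, fun e => congrFun hux e⟩
  by_contra hx
  -- Duality: a functional `f` separating `A x` from the image of `U` yields a combination `f ∘ₗ A`
  -- of the `Y e` that vanishes on `U` but not at `x`.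
  obtain ⟨f, hf, hU⟩ := Submodule.exists_le_ker_of_notMem hx
  refine hf ?_
  have hfA : f ∘ₗ A = ∑ e, f (Pi.single e 1) • Y e := by
    ext y
    simp only [LinearMap.comp_apply, LinearMap.sum_apply, LinearMap.smul_apply]
    conv_lhs => rw [← (Pi.basisFun K ι).sum_repr (A y)]
    simp [A, mul_comm]
  have hmem : f ∘ₗ A ∈ Submodule.span K (Set.range Y) := by
    rw [hfA]
    exact Submodule.sum_mem _ fun e _ => Submodule.smul_mem _ _ (Submodule.subset_span ⟨e, rfl⟩)
  have := h _ hmem fun u hu => hU ⟨u, hu, rfl⟩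
  exact LinearMap.congr_fun this x

/-! ### The secure code -/

namespace Network

variable {V E : Type*} [Fintype E] [DecidableEq E] {s : ℕ} (N : Network V E s)

/-- A secure code for a vector-linear function: the source vectors are masked by keys from a
subspace `Z`, and the columns of the target matrix are computed one after the other. -/
theorem exists_admissible_code {F : Type*} [Field F] [Fintype F] {k k' : ℕ}
    (T : Matrix (Fin s) (Fin k) F) (Υ : Matrix (Fin s) (Fin k') F) (r : ℕ)
    (L : Type) [Field L] [Finite L] [Algebra F L]
    (hL : ((2 ^ Fintype.card E : ℕ) : ENat) < ENat.card L) :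
    ∃ u : ℕ, N.cMin ≤ u + r ∧ N.ExistsAdmissibleCode F (vecLinear T) (wiretapSets E r)
      (vecLinear Υ) (Module.finrank F L * u) (Module.finrank F L * k) := by
  classical
  have : Module.Finite F L := Module.Finite.of_finite
  let M := Fin N.cMin → L
  obtain ⟨b, g, c, Y, hY1, hY2, hY3⟩ := N.exists_linear_sum_code L M hL (by simp [M])
  obtain ⟨Z, hZr, hZ⟩ := exists_submodule_forall_eq_zero (ι := {W : Finset E // W.card ≤ r})
    (lt_of_le_of_lt (by
      rw [← Fintype.card_finset]
      exact_mod_cast Fintype.card_subtype_le _) hL) r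
    (fun W => Submodule.span L (Set.range fun e : W.1 => Y e))
    (fun W => (finrank_range_le_card (R := L) fun e : W.1 => Y e).trans (by simpa using W.2))
  -- Whatever `W` can observe is also observed on some input built from keys alone.
  have hmask : ∀ W : Finset E, W.card ≤ r → ∀ x : Fin s → M,
      ∃ z : Fin s → M, (∀ i, z i ∈ Z) ∧ ∀ e ∈ W, Y e z = Y e x := by
    intro W hW x
    obtain ⟨z, hz, h⟩ := exists_mem_forall_apply_eq (fun e : W => Y e)
      (Submodule.pi Set.univ fun _ => Z)
      (fun φ hφ hvan => hZ ⟨W, hW⟩ φ hφ fun x hx => hvan x fun i _ => hx i) x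
    exact ⟨z, fun i => hz i (Set.mem_univ i), fun e he => h ⟨e, he⟩⟩
  refine ⟨Module.finrank L (M ⧸ Z), ?_, ?_⟩
  · have h1 := Z.finrank_quotient_add_finrank
    have h2 : Module.finrank L M = N.cMin := by simp [M]
    omega
  obtain ⟨σ, hσ⟩ := LinearMap.exists_rightInverse_of_surjective Z.mkQ Z.range_mkQ
  have hσ' : ∀ v, Z.mkQ (σ v) = v := LinearMap.congr_fun hσ
  have : Module.Finite F (M ⧸ Z) := Module.Finite.trans L (M ⧸ Z)
  let φ : (Fin (Module.finrank F L * Module.finrank L (M ⧸ Z)) → F) ≃ₗ[F] (M ⧸ Z) :=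
    LinearEquiv.ofFinrankEq _ _ (by rw [Module.finrank_mul_finrank]; simp)
  let ψ : (Fin (Module.finrank F L * k) → F) ≃ₗ[F] (Fin k → L) :=
    LinearEquiv.ofFinrankEq _ _ (by simp [Module.finrank_pi_fintype, mul_comm])
  -- Input to the run for column `j`: the same message in every run, scaled by `T i j`, with a fresh
  -- key for each column.
  let x : (Fin s → Fin (Module.finrank F L * Module.finrank L (M ⧸ Z)) → F) →
      (Fin s → Fin k → Z) → Fin k → Fin s → M :=
    fun m κ j i => algebraMap F L (T i j) • σ (φ (m i)) + κ i j
  let code : N.Code (fun _ => F) F (Fin k → F) (fun _ => Fin k → Z)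
      (Module.finrank F L * Module.finrank L (M ⧸ Z)) (Module.finrank F L * k) :=
    { encSource := fun e i _ p =>
        ψ.symm fun j => g i e (algebraMap F L (T i j) • σ (φ p.1) + p.2 j)
      encInner := fun e _ w => ψ.symm fun j =>
        ∑ d, if h : N.head d = N.tail e then c d e * ψ (w ⟨d, h⟩) j else 0
      dec := fun w l j => φ.symm (Z.mkQ
        (∑ d, if h : N.head d = N.sink then ψ (w ⟨d, h⟩) j • b d else 0)) l }
  have henc : ∀ m κ e, code.globalEnc m κ e = ψ.symm fun j => Y e (x m κ j) := by
    intro m κ e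
    induction e using N.edge_wf.induction with
    | h e ih =>
      by_cases h : ∃ i, N.tail e = N.source i
      · obtain ⟨i, hi⟩ := h
        rw [Code.globalEnc_source _ _ _ _ i hi]
        simp only [hY1 e i hi, code, x]
      · have h' := not_exists.1 h
        rw [Code.globalEnc_inner _ _ _ _ h']
        simp only [code, hY2 e h']
        congr 1
        funext j
        refine Finset.sum_congr rfl fun d _ => ?_
        split_ifs with hd
        · have := ih d hd
          simp only [code] at this
          rw [this, LinearEquiv.apply_symm_apply]
        · rfl
  refine ⟨fun _ => Fin k → Z, fun _ => ⟨inferInstance, inferInstance⟩, code, fun m κ => ?_,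
    fun W hW => ?_⟩
  · funext l j
    have h1 : ∑ d, (if h : N.head d = N.sink then
        ψ (code.globalEnc m κ d) j • b d else 0) = ∑ i, x m κ j i := by
      rw [← hY3 (x m κ j)]
      refine Finset.sum_congr rfl fun d _ => ?_
      split_ifs
      · rw [henc, LinearEquiv.apply_symm_apply]
      · rfl
    have h2 : Z.mkQ (∑ i, x m κ j i) = φ (∑ i, T i j • m i) := by
      rw [map_sum, map_sum]
      refine Finset.sum_congr rfl fun i _ => ?_
      have h3 : Z.mkQ (κ i j : M) = 0 := by simp
      simp only [x]
      rw [map_add, map_smul, hσ', h3, add_zero, algebraMap_smul, map_smul]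
    change φ.symm (Z.mkQ (∑ d, if h : N.head d = N.sink then
        ψ (code.globalEnc m κ d) j • b d else 0)) l = _
    rw [h1, h2, LinearEquiv.symm_apply_apply]
    simp [evalEach, vecLinear, Matrix.vecMul, dotProduct, mul_comm]
  · refine mutualInfo_eq_zero_of_card_fiber (fun ω (e : W) => code.globalEnc ω.1 ω.2 e)
      (evalEach (vecLinear Υ)) fun y m m' => ?_
    -- On `W`, `z j` imitates the effect of replacing `m'` by `m`. The translation of keys by `δ` is
    -- then a bijection between the key fibers of `m` and `m'`.
    choose z hzZ hz using fun j => hmask W hW (x m 0 j - x m' 0 j)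
    let δ : Fin s → Fin k → Z := fun i j => ⟨z j i, hzZ j i⟩
    have hshift : ∀ κ, ∀ e : W, code.globalEnc m κ e = code.globalEnc m' (κ + δ) e := by
      intro κ e
      rw [henc, henc]
      congr 1
      funext j
      have h1 : x m κ j = x m 0 j + fun i => (κ i j : M) := by
        funext i
        simp [x]
      have h2 : x m' (κ + δ) j = (x m' 0 j + fun i => (κ i j : M)) + z j := by
        funext i
        simp [x, δ, add_assoc]
      rw [h1, h2, map_add, map_add, map_add, hz j e e.2, map_sub]
      ring
    refine Nat.card_congr ((Equiv.addRight δ).subtypeEquiv fun κ => ?_)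
    simp only [Equiv.coe_addRight, hshift κ]

end Network

/-! ### Boundedness of rates and existence of the maximum -/

namespace Network

variable {V E : Type*} [Fintype E] [DecidableEq E] {s : ℕ} (N : Network V E s)

/-- A code that computes a nonzero vector-linear function has rate at most the number of edges. -/
theorem length_le_of_computes {F : Type*} [Field F] [Fintype F] {k : ℕ}
    {T : Matrix (Fin s) (Fin k) F} (hT : T ≠ 0) {K : Fin s → Type*} [∀ i, Nonempty (K i)]
    {ℓ n : ℕ} (c : N.Code (fun _ => F) F (Fin k → F) K ℓ n) (hc : c.Computes (vecLinear T)) :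
    ℓ ≤ Fintype.card E * n := by
  classical
  obtain ⟨i, j, hij⟩ : ∃ i j, T i j ≠ 0 := by
    by_contra! h
    exact hT (Matrix.ext h)
  let κ : ∀ i, K i := fun i => Classical.arbitrary (K i)
  let m : (Fin ℓ → F) → Fin s → Fin ℓ → F := fun a => Pi.single i a
  -- With only source `i` active, column `j` of the output is its message times `T i j ≠ 0`, so the
  -- edge words determine the message.
  have hinj : Function.Injective fun a => c.globalEnc (m a) κ := by
    intro a a' h
    have h1 : evalEach (vecLinear T) (m a) = evalEach (vecLinear T) (m a') := by
      rw [← hc (m a) κ, ← hc (m a') κ]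
      simp only at h
      rw [h]
    have h2 : ∀ (a : Fin ℓ → F) l, evalEach (vecLinear T) (m a) l j = a l * T i j := by
      intro a l
      simp only [evalEach, vecLinear, Matrix.vecMul, dotProduct, m]
      rw [Finset.sum_eq_single i]
      · simp
      · intro i' _ hi'
        simp [hi']
      · simp
    funext l
    refine mul_right_cancel₀ hij ?_
    rw [← h2, ← h2, h1]
  have hcard := Fintype.card_le_of_injective _ hinj
  simp only [Fintype.card_fun, Fintype.card_fin, ← pow_mul] at hcard
  rw [mul_comm]
  exact (Nat.pow_le_pow_iff_right Fintype.one_lt_card).1 hcard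

/-- A nonempty bounded rate region contains its supremum, the secure computing capacity. -/
theorem isGreatest_secureCapacity {A : Fin s → Type*} {B O Q : Type*} [Fintype B] [Fintype Q]
    (f : (∀ i, A i) → O) (𝒲 : Set (Finset E)) (ζ : (∀ i, A i) → Q)
    (hne : (N.rateRegion B f 𝒲 ζ).Nonempty) (hbdd : BddAbove (N.rateRegion B f 𝒲 ζ)) :
    IsGreatest (N.rateRegion B f 𝒲 ζ) (N.secureCapacity B f 𝒲 ζ) := by
  refine ⟨⟨?_, fun ε hε => ?_⟩, fun R hR => le_csSup hbdd hR⟩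
  · obtain ⟨R, hR⟩ := hne
    exact hR.1.trans (le_csSup hbdd hR)
  · obtain ⟨R, hR, hlt⟩ := exists_lt_of_lt_csSup hne
      (show N.secureCapacity B f 𝒲 ζ - ε / 2 < sSup _ from sub_lt_self _ (half_pos hε))
    obtain ⟨ℓ, n, hn, hcode, hrate⟩ := hR.2 (ε / 2) (half_pos hε)
    exact ⟨ℓ, n, hn, hcode, by linarith⟩

end Network

theorem mainTheorem6 {V E : Type*} [Fintype V] [Fintype E] [DecidableEq E] {s : ℕ}
    (N : Network V E s) {F : Type*} [Field F] [Fintype F] {k k' : ℕ}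
    (T : Matrix (Fin s) (Fin k) F) (hT : T ≠ 0) (Υ : Matrix (Fin s) (Fin k') F)
    (r : ℕ) (hr : r * k ≤ N.cMin) :
    IsGreatest (N.rateRegion F (vecLinear T) (wiretapSets E r) (vecLinear Υ))
        (N.secureCapacity F (vecLinear T) (wiretapSets E r) (vecLinear Υ)) ∧
      (N.cMin : ℝ) / (k : ℝ) - (r : ℝ) ≤
        N.secureCapacity F (vecLinear T) (wiretapSets E r) (vecLinear Υ) := by
  have hk : 0 < k := by
    rcases Nat.eq_zero_or_pos k with rfl | h
    · exact (hT (Subsingleton.elim _ _)).elim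
    · exact h
  obtain ⟨p, hp⟩ := CharP.exists F
  have : Fact p.Prime := ⟨CharP.char_is_prime F p⟩
  -- Since `F` has at least two elements, degree `|E| + 1` gives more than `2 ^ |E|` elements.
  let L := FiniteField.Extension F p (Fintype.card E + 1)
  have hL : ((2 ^ Fintype.card E : ℕ) : ENat) < ENat.card L := by
    rw [ENat.card_eq_coe_natCard, FiniteField.natCard_extension F p (Fintype.card E + 1)]
    have h2 : 2 ≤ Nat.card F := Finite.one_lt_card
    exact_mod_cast (Nat.pow_lt_pow_right one_lt_two (Nat.lt_succ_self _)).trans_le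
      (Nat.pow_le_pow_left h2 _)
  have : Module.Finite F L := Module.Finite.of_finite
  have ht : 0 < Module.finrank F L := Module.finrank_pos
  obtain ⟨u, hu, hcode⟩ := N.exists_admissible_code T Υ r L hL
  have hmem : (u : ℝ) / k ∈ N.rateRegion F (vecLinear T) (wiretapSets E r) (vecLinear Υ) := by
    refine ⟨by positivity, fun ε hε => ⟨_, _, Nat.mul_pos ht hk, hcode, ?_⟩⟩
    have ht' : (Module.finrank F L : ℝ) ≠ 0 := by exact_mod_cast ht.ne'
    push_cast
    rw [mul_div_mul_left _ _ ht']
    linarith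
  have hbdd : BddAbove (N.rateRegion F (vecLinear T) (wiretapSets E r) (vecLinear Υ)) := by
    -- The extra `1` absorbs the choice `ε = 1`.
    refine ⟨Fintype.card E + 1, fun R hR => ?_⟩
    obtain ⟨ℓ, n, hn, ⟨K, hK, c, hc, -⟩, hrate⟩ := hR.2 1 one_pos
    have : ∀ i, Nonempty (K i) := fun i => (hK i).2
    have hle : (ℓ : ℝ) / n ≤ Fintype.card E := by
      rw [div_le_iff₀ (by exact_mod_cast hn)]
      exact_mod_cast N.length_le_of_computes hT c hc
    linarith
  refine ⟨N.isGreatest_secureCapacity _ _ _ ⟨_, hmem⟩ hbdd, le_trans ?_ (le_csSup hbdd hmem)⟩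
  have hk' : (1 : ℝ) ≤ k := by exact_mod_cast hk
  have hu' : (N.cMin : ℝ) ≤ u + r := by exact_mod_cast hu
  -- Since `k ≥ 1`, the loss `r / k` in the rate of the code is at most `r`.
  have hrk : (r : ℝ) ≤ r * k := le_mul_of_one_le_right (Nat.cast_nonneg r) hk'
  rw [sub_le_iff_le_add, div_le_iff₀ (by linarith), add_mul, div_mul_cancel₀ _ (by linarith)]
  linarith
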